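/- Let $G$ be a finite directed multigraph with vertex set $V$ and adjacency matrix $D=(d_{ij})_{i,j\in V}$, where $d_{ij}\in\mathbb{N}$ is the number of edges from $i$ to $j$, and let $d_i=\sum_{j} d_{ij}$. Fix maps $\chi_i:\{1,\dots,d_i\}\to V$ ($i\in V$) that take each value $j$ exactly $d_{ij}$ times. The directed cover $\mathcal{T}_i$ of $G$ is the rooted plane tree with vertices labelled by $V$, whose root $r$ has label $i$ and in which every vertex $x$ with label $l$ has $d_l$ children $x^{(1)},\dots,x^{(d_l)}$, the child $x^{(k)}$ having label $\chi_l(k)$. Write $x^{(0)}$ for the parent of $x$, where an additional vertex $r^{(0)}$ is attached to the root as its parent, and $|x|$ for the distance from $r$ to $x$. For $h\ge 1$ let $\mathcal{T}_i^h$ be the finite tree induced by $r^{(0)}$ and the vertices with $|x|\le h$. Put $s_+=\{r^{(0)}\}$ (the down sink), $s^-=\{x:|x|=h\}$ (the up sink) and $S=s_+\cup s^-$. The wired cover $\widetilde{\mathcal{T}}_i^h$ is the multigraph obtained from $\mathcal{T}_i^h$ by collapsing $S$ to a single vertex, the sink, and keeping multiple edges. Fix at every non-sink vertex $x$ of $\widetilde{\mathcal{T}}_i^h$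 an arbitrary cyclic order of the edges at $x$. A rotor configuration $\rho$ chooses an edge $\rho(x)$ at every non-sink vertex $x$. It is recurrent if the chosen edges, directed away from $x$, contain no directed cycle, that is, if they form an oriented spanning tree rooted at the sink. In one step of the rotor-router walk, the rotor at the current position of the particle is advanced to the next edge in the cyclic order, and then the particle moves along that edge. Let $e_x(\rho)$ be the rotor configuration that results when a particle is started at $x$ with rotors $\rho$ and walks until it reaches the sink. Each $e_x$ is a well-defined permutation of the set of recurrent configurations. The rotor-router group $\mathsf{RR}(\widetilde{\mathcal{T}}_i^h)$ is the group of permutations of this set that is generated by all $e_x$, where $x$ runs through the non-sink vertices. A spanning forest of $\mathcal{T}_i^h$ (a cycle-free spanning subgraph) is rooted at $S$ if each of its connected components contains exactly one vertex of $S$. Let $F^h_{i,+}$ be the number of spanning forests of $\mathcal{T}_i^h$ rooted at $S$ that contain the edge from $r$ to $r^{(0)}$, and let $F^h_{i,-}$ be the number of those that contain a path from $r$ to a vertex of $s^-$. Then for all $i\in V$ and $h\ge 1$ $$\big|\mathsf{RR}(\widetilde{\mathcal{T}}_i^h)\big| = F^h_{i,+}+F^h_{i,-}.$$ For all $i\in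 V$ and $h\ge 2$ $$F^h_{i,+}=\prod_{j\in V}\big(F^{h-1}_{j,+}+F^{h-1}_{j,-}\big)^{d_{ij}},\qquad F^h_{i,-}=F^h_{i,+}\sum_{j\in V}\frac{d_{ij}\,F^{h-1}_{j,-}}{F^{h-1}_{j,+}+F^{h-1}_{j,-}},$$ and $F^1_{i,+}=1$, $F^1_{i,-}=d_i$ for all $i\in V$. -/

import Mathlib

/-! ### Rotor-router walks on a multigraph with a sink -/

/-- A multigraph with a sink, together with a rotor sequence at every non-sink vertex.
`W` is the set of non-sink vertices and the sink is `none : Option W`. The edges at `x` are indexed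
by `Fin (deg x)`, in the cyclic order in which the rotor at `x` runs through them, and `nbr x k` is
the other endpoint of the `k`-th edge. Multiple edges are allowed and are kept apart. -/
structure RotorGraph (W : Type*) where
  deg : W → ℕ
  nbr : (x : W) → Fin (deg x) → Option W

namespace RotorGraph

variable {W : Type*} (G : RotorGraph W)

/-- A rotor configuration: an edge chosen at every non-sink vertex. -/
abbrev Config : Type _ := (x : W) → Fin (G.deg x)

open Classical in
/-- One step of the walk. A particle at a non-sink vertex `x` first advances the rotor at `x`
cyclically by one and then moves along the new rotor. A particle at the sink stays there. -/
noncomputable def step : G.Config × Option W → G.Config × Option W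
  | (ρ, none) => (ρ, none)
  | (ρ, some x) =>
      (Function.update ρ x (finRotate (G.deg x) (ρ x)), G.nbr x (finRotate (G.deg x) (ρ x)))

/-- `e_x(ρ) = ρ'`: a particle that starts at `x` with rotors `ρ` reaches the sink, and the
rotors are then `ρ'`. (At most one `ρ'` has this property, since the sink is absorbing.) -/
def RoutesTo (x : W) (ρ ρ' : G.Config) : Prop :=
  ∃ n : ℕ, G.step^[n] (ρ, some x) = (ρ', none)

/-- The edges chosen by `ρ` contain no directed cycle, that is, they form an oriented spanning
tree (rooted at the sink). -/
def IsAcyclicConfig (ρ : G.Config) : Prop :=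
  ∀ x : W, ¬ Relation.TransGen (fun y z => G.nbr y (ρ y) = some z) x x

/-- The recurrent configurations, that is, the oriented spanning trees. -/
abbrev Rec : Type _ := {ρ : G.Config // G.IsAcyclicConfig ρ}

/-- The permutation `f` of the recurrent configurations is the particle addition operator `e_x`. -/
def IsParticleAddition (x : W) (f : Equiv.Perm G.Rec) : Prop :=
  ∀ ρ : G.Rec, G.RoutesTo x ρ.1 (f ρ).1

/-- The rotor-router group: the group of permutations of the recurrent configurations that is
generated by the particle addition operators `e_x`. -/
def rotorRouterGroup : Subgroup (Equiv.Perm G.Rec) :=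
  Subgroup.closure {f | ∃ x : W, G.IsParticleAddition x f}

end RotorGraph

/-! ### Rooted spanning forests -/

/-- `F` is a spanning forest of `H` rooted at `S`: a cycle-free spanning subgraph, each of whose
connected components contains exactly one vertex of `S`. -/
def IsRootedSpanningForest {U : Type*} (H : SimpleGraph U) (S : Set U) (F : SimpleGraph U) : Prop :=
  F ≤ H ∧ F.IsAcyclic ∧ ∀ C : F.ConnectedComponent, ∃! s : U, s ∈ S ∧ F.connectedComponentMk s = C

/-! ### Directed covers -/

/-- The out-degree `d_i` of the vertex `i` of the multigraph with adjacency matrix `D`. -/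
def outDeg {V : Type*} [Fintype V] (D : Matrix V V ℕ) (i : V) : ℕ := ∑ j, D i j

section Cover

universe u

variable {V : Type u} [Fintype V] {D : Matrix V V ℕ}

/-- The vertices of the directed cover with root type `i` and generation function `χ`: either the
root, or a vertex of the `k`-th principal branch, which is the directed cover with root type
`χ i k`, for `k` among the `d_i` children of the root. -/
inductive CoverVertex (χ : (i : V) → Fin (outDeg D i) → V) : V → Type u
  | root {i : V} : CoverVertex χ i
  | branch {i : V} (k : Fin (outDeg D i)) (x : CoverVertex χ (χ i k)) : CoverVertex χ i

namespace CoverVertex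

variable {χ : (i : V) → Fin (outDeg D i) → V}

/-- The type (label) of a vertex. -/
def type : {i : V} → CoverVertex χ i → V
  | i, root => i
  | _, branch _ x => x.type

/-- The height of a vertex, its distance from the root. -/
def height : {i : V} → CoverVertex χ i → ℕ
  | _, root => 0
  | _, branch _ x => x.height + 1

/-- The `k`-th child of a vertex, which has type `χ x.type k`. -/
def child : {i : V} → (x : CoverVertex χ i) → Fin (outDeg D x.type) → CoverVertex χ i
  | _, root, k => branch k root
  | _, branch l x, k => branch l (x.child k)

/-- The ancestor of a vertex; `none` stands for the additional vertex that is attached to the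
root as its ancestor. -/
def ancestor : {i : V} → CoverVertex χ i → Option (CoverVertex χ i)
  | _, root => none
  | _, branch k x => some (x.ancestor.elim root (branch k))

/-- The neighbours of `x`: number `0` is the ancestor and number `k + 1` is the `k`-th child
(with `k` counted from `0`). -/
def nbr {i : V} (x : CoverVertex χ i) : Fin (outDeg D x.type + 1) → Option (CoverVertex χ i) :=
  Fin.cons x.ancestor (fun k => some (x.child k))

theorem type_child : ∀ {i : V} (x : CoverVertex χ i) (k : Fin (outDeg D x.type)),
    (x.child k).type = χ x.type k
  | _, root, _ => rfl
  | _, branch _ x, k => type_child x k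

theorem height_child : ∀ {i : V} (x : CoverVertex χ i) (k : Fin (outDeg D x.type)),
    (x.child k).height = x.height + 1
  | _, root, _ => rfl
  | _, branch _ x, k => congrArg (· + 1) (height_child x k)

theorem ancestor_child : ∀ {i : V} (x : CoverVertex χ i) (k : Fin (outDeg D x.type)),
    (x.child k).ancestor = some x
  | _, root, _ => rfl
  | _, branch l x, k => by simp [child, ancestor, ancestor_child x k]

end CoverVertex

variable (χ : (i : V) → Fin (outDeg D i) → V) (i : V) (h : ℕ)

/-- The directed cover with root type `i`, with the additional vertex `none` attached to its root
as the ancestor of the root. -/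
def plantedCover : SimpleGraph (Option (CoverVertex χ i)) :=
  SimpleGraph.fromRel fun a b => ∃ (x : CoverVertex χ i) (k : Fin (outDeg D x.type + 1)),
    a = some x ∧ b = x.nbr k

/-- The vertices of the truncated cover of height `h`: those of height at most `h`, and the
ancestor of the root. -/
def truncVertices : Set (Option (CoverVertex χ i)) :=
  {v | ∀ x : CoverVertex χ i, v = some x → x.height ≤ h}

/-- The truncated cover of height `h`, with the ancestor of the root attached. -/
def truncCover : SimpleGraph (truncVertices χ i h) :=
  (plantedCover χ i).induce (truncVertices χ i h)

/-- The root as a vertex of the truncated cover. -/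
def truncRoot : truncVertices χ i h :=
  ⟨some CoverVertex.root, fun x hx => by cases hx; exact Nat.zero_le h⟩

/-- The down sink: the ancestor of the root. -/
def downSink : truncVertices χ i h :=
  ⟨none, fun x hx => by cases hx⟩

/-- The up sink: the set of all vertices of height exactly `h`. -/
def upSink : Set (truncVertices χ i h) :=
  {v | ∃ x : CoverVertex χ i, v.1 = some x ∧ x.height = h}

/-- The number of spanning forests of the truncated cover, rooted at the union of the down sink
and the up sink, that contain the edge from the root to the down sink. -/
noncomputable def forestsDown : ℕ :=
  Set.ncard {F : SimpleGraph (truncVertices χ i h) |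
    IsRootedSpanningForest (truncCover χ i h) ({downSink χ i h} ∪ upSink χ i h) F ∧
      F.Adj (truncRoot χ i h) (downSink χ i h)}

/-- The number of spanning forests of the truncated cover, rooted at the union of the down sink
and the up sink, that contain a path from the root to the up sink. -/
noncomputable def forestsUp : ℕ :=
  Set.ncard {F : SimpleGraph (truncVertices χ i h) |
    IsRootedSpanningForest (truncCover χ i h) ({downSink χ i h} ∪ upSink χ i h) F ∧
      ∃ s ∈ upSink χ i h, F.Reachable (truncRoot χ i h) s}

/-- The non-sink vertices of the wired cover of height `h`. -/
abbrev WiredVertex : Type u := {x : CoverVertex χ i // x.height < h}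

open Classical in
/-- The collapsing map: the ancestor of the root and all vertices of height `h` become the single
sink `none`; all other vertices of the truncated cover are kept. -/
noncomputable def collapse : Option (CoverVertex χ i) → Option (WiredVertex χ i h)
  | none => none
  | some x => if hx : x.height < h then some ⟨x, hx⟩ else none

/-- The wired cover of height `h`: the truncated cover with both sinks collapsed to one vertex and
with multiple edges kept. The rotor sequence at `x` is given by `c x`, which is an arbitrary
enumeration of the neighbours `0, ..., d` of `x` in the tree (with `d` the number of children). -/
noncomputable def wiredCover
    (c : (x : WiredVertex χ i h) → Equiv.Perm (Fin (outDeg D x.1.type + 1))) :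
    RotorGraph (WiredVertex χ i h) where
  deg x := outDeg D x.1.type + 1
  nbr x k := collapse χ i h (x.1.nbr (c x k))

end Cover

/-! The order of the group is the number of oriented spanning trees, because the group acts simply
transitively on them. A walk is recorded by its flow, the number of times each edge is used. The
flow satisfies a rotation equation at every vertex (`IsRotation`) and a balance equation for the
particles (`netFlow`); integer flows allow walks to be reversed and composed. The crux is
`FlowEquiv.eq`: two acyclic configurations joined by a flow that preserves the particles are equal,
since otherwise the final rotors, or for the reversed flow the initial ones, would stay inside the
set of emitting vertices and contain a cycle. Hence each `e_x` is injective, every group element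
amounts to the addition of a fixed particle vector, the group is abelian, and any acyclic
configuration can be carried to any other by a suitable vector. This gives `card_rotorRouterGroup`.

Following the rotors identifies acyclic configurations with spanning forests rooted at the sinks
(`IsCollapse.ncard_forests`), whatever the cyclic orders. In a tree the only possible directed
cycles are two-cycles along an edge (`isAcyclicConfig_iff_noBacktrack`). The condition therefore
splits at the root: a root pointing to its ancestor leaves all branches free, and a root pointing to
a child only forces that branch to lead up. Counting both cases gives the recursion. -/

/-! ### Flows of rotor-router walks -/

/-- `f` counts, with sign, how often each of the `d` edges at a vertex is used while the rotor moves
from position `a` to position `b`. -/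
def IsRotation {d : ℕ} (a b : Fin d) (f : Fin d → ℤ) : Prop :=
  ∀ k, f (finRotate d k) = f k + (if a = k then 1 else 0) - (if b = k then 1 else 0)

namespace IsRotation

variable {d : ℕ} {a b c : Fin d} {f g : Fin d → ℤ}

theorem trans (hf : IsRotation a b f) (hg : IsRotation b c g) : IsRotation a c (f + g) := by
  intro k
  have h1 := hf k
  have h2 := hg k
  simp only [Pi.add_apply]
  omega

theorem symm (hf : IsRotation a b f) : IsRotation b a (-f) := by
  intro k
  have h1 := hf k
  simp only [Pi.neg_apply]
  omega

theorem refl (a : Fin d) : IsRotation a a 0 := by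
  intro k
  simp

theorem rotate (a : Fin d) : IsRotation a (finRotate d a) (Pi.single (finRotate d a) 1) := by
  intro k
  simp only [Pi.single_apply, EmbeddingLike.apply_eq_iff_eq, eq_comm (a := k)]
  omega

/-- A rotation is determined up to an additive constant, the number of full turns. -/
theorem apply_eq {n : ℕ} {a b : Fin (n + 1)} {f : Fin (n + 1) → ℤ} (hf : IsRotation a b f)
    (k : Fin (n + 1)) : f k = f 0 + (if a < k then 1 else 0) - (if b < k then 1 else 0) := by
  induction k using Fin.induction with
  | zero => simp
  | succ k ih =>
    have h1 := hf k.castSucc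
    rw [finRotate_apply, Fin.coeSucc_eq_succ] at h1
    rw [h1, ih]
    have h2 : ∀ a : Fin (n + 1), (if a < k.succ then (1 : ℤ) else 0) =
        (if a < k.castSucc then 1 else 0) + (if a = k.castSucc then 1 else 0) := by
      intro a
      simp only [Fin.lt_def, Fin.ext_iff, Fin.val_succ, Fin.val_castSucc]
      split_ifs <;> omega
    rw [h2 a, h2 b]
    ring

theorem exists_flow (a b : Fin d) : ∃ f, IsRotation a b f := by
  cases d with
  | zero => exact a.elim0
  | succ n =>
    refine ⟨fun k => (if a < k then 1 else 0) - (if b < k then 1 else 0), fun k => ?_⟩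
    rw [finRotate_apply]
    induction k using Fin.lastCases with
    | last =>
      simp only [Fin.last_add_one, Fin.lt_def, Fin.ext_iff, Fin.val_last, Fin.val_zero]
      have := a.2
      have := b.2
      split_ifs <;> omega
    | cast k =>
      simp only [Fin.coeSucc_eq_succ, Fin.lt_def, Fin.ext_iff, Fin.val_succ, Fin.val_castSucc]
      split_ifs <;> omega

/-- The edge at which the rotor stops is used at least as often as any other. With `last_le` this
confines `f` to two consecutive integers, so `f` cannot change sign. -/
theorem le_last (hf : IsRotation a b f) (k : Fin d) : f k ≤ f b := by
  cases d with
  | zero => exact a.elim0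
  | succ n =>
    rw [hf.apply_eq k, hf.apply_eq b]
    simp only [Fin.lt_def]
    split_ifs <;> omega

theorem last_le (hf : IsRotation a b f) (k : Fin d) : f b ≤ f k + 1 := by
  cases d with
  | zero => exact a.elim0
  | succ n =>
    rw [hf.apply_eq k, hf.apply_eq b]
    simp only [Fin.lt_def]
    split_ifs <;> omega

theorem eq_of_refl (hf : IsRotation a a f) (k l : Fin d) : f k = f l := by
  cases d with
  | zero => exact a.elim0
  | succ n =>
    rw [hf.apply_eq k, hf.apply_eq l]
    ring

theorem sign (hf : IsRotation a b f) : (∀ k, 0 ≤ f k) ∨ ∀ k, f k ≤ 0 := by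
  by_cases h : 0 < f b
  · exact .inl fun k => by have := hf.last_le k; omega
  · exact .inr fun k => by have := hf.le_last k; omega

theorem eq_of_zero (hf : IsRotation a b 0) : a = b := by
  have := hf a
  simp only [Pi.zero_apply, if_true] at this
  by_contra hab
  rw [if_neg (Ne.symm hab)] at this
  omega

end IsRotation

/-! ### Acyclic configurations, termination and uniqueness via flows. -/

namespace RotorGraph

variable {W : Type*} {G : RotorGraph W}

/-- Cycles are handled throughout as nonempty sets that the rotors never leave; here the set of
vertices whose rotor path meets `x`. The converse on finite graphs is `IsAcyclicConfig.not_closed`.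
-/
theorem exists_closed_of_not_isAcyclicConfig {ρ : G.Config} (hρ : ¬ G.IsAcyclicConfig ρ) :
    ∃ P : Set W, P.Nonempty ∧ ∀ y ∈ P, ∃ z ∈ P, G.nbr y (ρ y) = some z := by
  simp only [IsAcyclicConfig, not_forall, not_not] at hρ
  obtain ⟨x, hx⟩ := hρ
  refine ⟨{y | Relation.TransGen (fun y z => G.nbr y (ρ y) = some z) y x}, ⟨x, hx⟩, ?_⟩
  intro y hy
  obtain ⟨z, hyz, hzx⟩ := Relation.TransGen.head'_iff.1 hy
  rcases Relation.reflTransGen_iff_eq_or_transGen.1 hzx with h | h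
  · subst h
    exact ⟨_, hx, hyz⟩
  · exact ⟨z, h, hyz⟩

theorem IsAcyclicConfig.wellFounded [Finite W] {ρ : G.Config} (hρ : G.IsAcyclicConfig ρ) :
    WellFounded fun z y => G.nbr y (ρ y) = some z := by
  have h1 : WellFounded (Relation.TransGen fun z y => G.nbr y (ρ y) = some z) := by
    have : Std.Irrefl (Relation.TransGen fun z y => G.nbr y (ρ y) = some z) :=
      ⟨fun x hx => hρ x (Relation.transGen_swap.1 hx)⟩
    exact Finite.wellFounded_of_trans_of_irrefl _
  exact h1.mono fun _ _ h => Relation.TransGen.single h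

theorem IsAcyclicConfig.not_closed [Finite W] {ρ : G.Config} (hρ : G.IsAcyclicConfig ρ)
    {P : Set W} (hP : P.Nonempty) (h : ∀ y ∈ P, ∃ z ∈ P, G.nbr y (ρ y) = some z) : False := by
  obtain ⟨y, hy, hmin⟩ := hρ.wellFounded.has_min P hP
  obtain ⟨z, hz, hyz⟩ := h y hy
  exact hmin z hz hyz

open Classical in
/-- The property that the rotors away from the particle contain no directed cycle is preserved. -/
theorem not_closed_iterate_step (n : ℕ) {ρ : G.Config} {o : Option W}
    (h : ∀ P : Set W, P.Nonempty →
      ¬ ∀ y ∈ P, some y ≠ o ∧ ∃ z ∈ P, G.nbr y (ρ y) = some z)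
    (P : Set W) (hP : P.Nonempty) :
    ¬ ∀ y ∈ P, some y ≠ (G.step^[n] (ρ, o)).2 ∧
      ∃ z ∈ P, G.nbr y ((G.step^[n] (ρ, o)).1 y) = some z := by
  induction n generalizing ρ o with
  | zero => exact h P hP
  | succ n ih =>
    refine ih (ρ := (G.step (ρ, o)).1) (o := (G.step (ρ, o)).2) fun P hP hclosed => ?_
    cases o with
    | none => exact h P hP hclosed
    | some x =>
      simp only [step] at hclosed
      -- If `x` lies in `P`, its new rotor points to the particle's new position, which would then
      -- be a vertex of `P`. Otherwise the rotors on `P` are unchanged.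
      by_cases hx : x ∈ P
      · obtain ⟨-, z, hz, hxz⟩ := hclosed x hx
        rw [Function.update_self] at hxz
        exact (hclosed z hz).1 hxz.symm
      · refine h P hP fun y hy => ?_
        have hyx : y ≠ x := fun h => hx (h ▸ hy)
        obtain ⟨-, z, hz, hyz⟩ := hclosed y hy
        rw [Function.update_of_ne hyx] at hyz
        exact ⟨fun h => hyx (Option.some.inj h), z, hz, hyz⟩

open Classical in
/-- A single particle at `o`; particles at the sink are not counted. -/
noncomputable def particle (o : Option W) (z : W) : ℤ := if o = some z then 1 else 0

theorem particle_none : particle (none : Option W) = 0 := by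
  funext z
  simp [particle]

variable [Fintype W]

open Classical in
/-- The net number of particles that arrive at `z` when the edges are used as often as `f` says. -/
noncomputable def netFlow (f : (y : W) → Fin (G.deg y) → ℤ) (z : W) : ℤ :=
  (∑ y, ∑ k, if G.nbr y k = some z then f y k else 0) - ∑ k, f z k

theorem netFlow_add (f g : (y : W) → Fin (G.deg y) → ℤ) :
    netFlow (f + g) = netFlow f + netFlow g := by
  funext z
  simp only [netFlow, Pi.add_apply, Finset.sum_add_distrib, ite_add_zero]
  ring

open Classical in
theorem netFlow_neg (f : (y : W) → Fin (G.deg y) → ℤ) : netFlow (-f) = -netFlow f := by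
  funext z
  have : ∀ y k, (if G.nbr y k = some z then -f y k else 0) =
      -(if G.nbr y k = some z then f y k else 0) := fun y k => by split_ifs <;> simp
  simp only [netFlow, Pi.neg_apply, this, Finset.sum_neg_distrib]
  ring

theorem netFlow_zero : netFlow (0 : (y : W) → Fin (G.deg y) → ℤ) = 0 := by
  funext z
  simp [netFlow]

/-- The configuration `ρ` with particles `σ` (possibly negative in number) is turned into `ρ'` with
particles `σ'` when the edges are used as often as `f` says. -/
structure IsFlow (ρ : G.Config) (σ : W → ℤ) (ρ' : G.Config) (σ' : W → ℤ)
    (f : (y : W) → Fin (G.deg y) → ℤ) : Prop where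
  rotation : ∀ y, IsRotation (ρ y) (ρ' y) (f y)
  balance : σ' = σ + netFlow f

/-- Two configurations with particles can be turned into each other by rotor moves, forwards
and backwards. -/
def FlowEquiv (ρ : G.Config) (σ : W → ℤ) (ρ' : G.Config) (σ' : W → ℤ) : Prop :=
  ∃ f, IsFlow ρ σ ρ' σ' f

theorem IsFlow.trans {ρ ρ' ρ'' : G.Config} {σ σ' σ'' : W → ℤ} {f g}
    (hf : IsFlow ρ σ ρ' σ' f) (hg : IsFlow ρ' σ' ρ'' σ'' g) : IsFlow ρ σ ρ'' σ'' (f + g) :=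
  ⟨fun y => (hf.rotation y).trans (hg.rotation y), by
    rw [hg.balance, hf.balance, netFlow_add, add_assoc]⟩

theorem IsFlow.symm {ρ ρ' : G.Config} {σ σ' : W → ℤ} {f} (hf : IsFlow ρ σ ρ' σ' f) :
    IsFlow ρ' σ' ρ σ (-f) :=
  ⟨fun y => (hf.rotation y).symm, by rw [hf.balance, netFlow_neg]; abel⟩

theorem IsFlow.refl (ρ : G.Config) (σ : W → ℤ) : IsFlow ρ σ ρ σ 0 :=
  ⟨fun y => .refl _, by rw [netFlow_zero, add_zero]⟩

theorem FlowEquiv.trans {ρ ρ' ρ'' : G.Config} {σ σ' σ'' : W → ℤ}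
    (h : FlowEquiv ρ σ ρ' σ') (h' : FlowEquiv ρ' σ' ρ'' σ'') : FlowEquiv ρ σ ρ'' σ'' :=
  h.elim fun _ hf => h'.elim fun _ hg => ⟨_, hf.trans hg⟩

theorem FlowEquiv.symm {ρ ρ' : G.Config} {σ σ' : W → ℤ} (h : FlowEquiv ρ σ ρ' σ') :
    FlowEquiv ρ' σ' ρ σ :=
  h.elim fun _ hf => ⟨_, hf.symm⟩

theorem FlowEquiv.add_right {ρ ρ' : G.Config} {σ σ' : W → ℤ} (h : FlowEquiv ρ σ ρ' σ')
    (τ : W → ℤ) : FlowEquiv ρ (σ + τ) ρ' (σ' + τ) :=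
  h.elim fun f hf => ⟨f, hf.rotation, by rw [hf.balance]; abel⟩

/-- The edges used by a balanced flow lead back into the set of vertices that emit particles. -/
theorem exists_pos_of_netFlow_eq_zero {f : (y : W) → Fin (G.deg y) → ℤ}
    (hsign : ∀ y, (∀ k, 0 ≤ f y k) ∨ ∀ k, f y k ≤ 0) (hf : netFlow f = 0)
    {y : W} {k : Fin (G.deg y)} (hyk : 0 < f y k) :
    ∃ z, (∃ l, 0 < f z l) ∧ G.nbr y k = some z := by
  classical
  let P : W → Prop := fun z => ∃ l, 0 < f z l
  let Q : (y : W) → Fin (G.deg y) → Prop := fun y k => ∃ z, P z ∧ G.nbr y k = some z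
  -- Summing `netFlow f = 0` over `P` says that outflow from `P` equals inflow into `P`, so `t` has
  -- total zero. Each term is nonnegative: `f` is nonnegative on edges from `P` and nonpositive on
  -- all others. Thus no edge with positive flow leaves `P`.
  let t : (y : W) → Fin (G.deg y) → ℤ := fun y k =>
    (if P y then f y k else 0) - if Q y k then f y k else 0
  have hsum : ∑ y, ∑ k, t y k = 0 := by
    have h1 : ∑ z, (if P z then netFlow f z else 0) = 0 := by
      simp [hf]
    have h2 : ∀ y k, (∑ z, if P z then (if G.nbr y k = some z then f y k else 0) else 0) =
        if Q y k then f y k else 0 := by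
      intro y k
      by_cases hQ : Q y k
      · obtain ⟨z, hz, hyz⟩ := hQ
        rw [if_pos ⟨z, hz, hyz⟩, Finset.sum_eq_single z]
        · rw [if_pos hz, if_pos hyz]
        · intro w _ hw
          rw [hyz, if_neg (fun h => hw (Option.some.inj h).symm), ite_self]
        · simp
      · rw [if_neg hQ]
        refine Finset.sum_eq_zero fun z _ => ?_
        split_ifs with hz hyz
        · exact absurd ⟨z, hz, hyz⟩ hQ
        · rfl
        · rfl
    have h3 : ∑ z, (if P z then netFlow f z else 0) =
        (∑ y, ∑ k, if Q y k then f y k else 0) - ∑ y, ∑ k, if P y then f y k else 0 := by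
      simp_rw [← h2]
      rw [Finset.sum_congr rfl fun y _ => Finset.sum_comm, Finset.sum_comm,
        ← Finset.sum_sub_distrib]
      refine Finset.sum_congr rfl fun z _ => ?_
      by_cases hz : P z
      · simp [netFlow, hz]
      · simp [hz]
    simp only [t, Finset.sum_sub_distrib]
    omega
  have hnonneg : ∀ y k, 0 ≤ t y k := by
    intro y k
    simp only [t]
    by_cases hy : P y
    · obtain ⟨l, hl⟩ := hy
      have h0 : ∀ k, 0 ≤ f y k := by
        rcases hsign y with h | h
        · exact h
        · exact absurd (h l) (by omega)
      have := h0 k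
      rw [if_pos ⟨l, hl⟩]
      split_ifs <;> omega
    · have : f y k ≤ 0 := not_lt.1 fun h => hy ⟨k, h⟩
      rw [if_neg hy]
      split_ifs <;> omega
  have h4 := (Finset.sum_eq_zero_iff_of_nonneg fun y _ => Finset.sum_nonneg fun k _ =>
    hnonneg y k).1 hsum y (Finset.mem_univ _)
  have h5 := (Finset.sum_eq_zero_iff_of_nonneg fun k _ => hnonneg y k).1 h4 k (Finset.mem_univ _)
  by_contra hQ
  simp only [t] at h5
  rw [if_pos ⟨k, hyk⟩, if_neg hQ] at h5
  omega

/-- A vertex with positive flow on some edge has it on its final rotor by `le_last`, and that edge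
leads to another such vertex. So the set of these vertices would be closed under `ρ'`. -/
theorem IsFlow.nonpos {ρ ρ' : G.Config} {σ : W → ℤ} {f} (hf : IsFlow ρ σ ρ' σ f)
    (hρ' : G.IsAcyclicConfig ρ') (y : W) (k : Fin (G.deg y)) : f y k ≤ 0 := by
  by_contra! h
  refine hρ'.not_closed (P := {y | ∃ k, 0 < f y k}) ⟨y, k, h⟩ fun y ⟨k, hk⟩ => ?_
  exact exists_pos_of_netFlow_eq_zero (fun y => (hf.rotation y).sign)
    (left_eq_add.1 hf.balance) (hk.trans_le ((hf.rotation y).le_last k))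

/-- `nonpos` applied to the flow and to its reverse forces the flow to vanish. -/
theorem FlowEquiv.eq {ρ ρ' : G.Config} {σ : W → ℤ} (h : FlowEquiv ρ σ ρ' σ)
    (hρ : G.IsAcyclicConfig ρ) (hρ' : G.IsAcyclicConfig ρ') : ρ = ρ' := by
  obtain ⟨f, hf⟩ := h
  funext y
  have h0 : f y = 0 := by
    funext k
    have h1 := hf.nonpos hρ' y k
    have h2 := hf.symm.nonpos hρ y k
    simp only [Pi.neg_apply] at h2
    simp only [Pi.zero_apply]
    omega
  have := hf.rotation y
  rw [h0] at this
  exact this.eq_of_zero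

open Classical in
theorem isFlow_step (ρ : G.Config) (x : W) :
    IsFlow ρ (particle (some x)) (G.step (ρ, some x)).1 (particle (G.step (ρ, some x)).2)
      (Pi.single x (Pi.single (finRotate _ (ρ x)) 1)) := by
  constructor
  · intro y
    simp only [step]
    by_cases hy : y = x
    · subst hy
      rw [Function.update_self, Pi.single_eq_same]
      exact .rotate _
    · rw [Function.update_of_ne hy, Pi.single_eq_of_ne hy]
      exact .refl _
  · funext z
    have h1 : (∑ y, ∑ k, if G.nbr y k = some z then
        (Pi.single x (Pi.single (finRotate _ (ρ x)) 1) : (y : W) → Fin (G.deg y) → ℤ) y k else 0) =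
        particle (G.nbr x (finRotate _ (ρ x))) z := by
      rw [Finset.sum_eq_single x]
      · rw [Finset.sum_eq_single (finRotate _ (ρ x))]
        · simp [particle]
        · intro k _ hk
          rw [Pi.single_eq_same, Pi.single_eq_of_ne hk, ite_self]
        · simp
      · intro y _ hy
        simp [Pi.single_eq_of_ne hy]
      · simp
    have h2 : (∑ k, (Pi.single x (Pi.single (finRotate _ (ρ x)) 1) :
        (y : W) → Fin (G.deg y) → ℤ) z k) = particle (some x) z := by
      by_cases hz : z = x
      · subst hz
        simp [particle]
      · rw [Pi.single_eq_of_ne hz]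
        simp [particle, Ne.symm hz]
    simp only [step, Pi.add_apply, netFlow, h1, h2]
    ring

open Classical in
theorem exists_isFlow_iterate_step (n : ℕ) (ρ : G.Config) (o : Option W) :
    ∃ f, IsFlow ρ (particle o) (G.step^[n] (ρ, o)).1 (particle (G.step^[n] (ρ, o)).2) f ∧
      0 ≤ f ∧ ∀ x, o = some x → 0 < n → ∃ k, 0 < f x k := by
  induction n generalizing ρ o with
  | zero => exact ⟨0, .refl _ _, le_rfl, by simp⟩
  | succ n ih =>
    cases o with
    | none =>
      obtain ⟨f, hf, h0, -⟩ := ih ρ none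
      exact ⟨f, hf, h0, by simp⟩
    | some x =>
      obtain ⟨f, hf, h0, -⟩ := ih (G.step (ρ, some x)).1 (G.step (ρ, some x)).2
      have h1 : (0 : (y : W) → Fin (G.deg y) → ℤ) ≤
          Pi.single x (Pi.single (finRotate _ (ρ x)) 1) := by
        rw [Pi.single_nonneg, Pi.single_nonneg]
        exact zero_le_one
      refine ⟨_, (isFlow_step ρ x).trans hf, add_nonneg h1 h0, ?_⟩
      rintro _ ⟨rfl⟩ -
      refine ⟨finRotate _ (ρ x), ?_⟩
      have := h0 x (finRotate _ (ρ x))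
      simp only [Pi.zero_apply] at this
      simp only [Pi.add_apply, Pi.single_eq_same]
      omega

theorem flowEquiv_of_routesTo {x : W} {ρ ρ' : G.Config} (h : G.RoutesTo x ρ ρ') :
    FlowEquiv ρ (particle (some x)) ρ' 0 := by
  obtain ⟨n, hn⟩ := h
  obtain ⟨f, hf, -⟩ := exists_isFlow_iterate_step n ρ (some x)
  rw [hn, particle_none] at hf
  exact ⟨f, hf⟩

/-- A walk that never reaches the sink repeats a state. Over the loop every rotor makes full turns,
so a visited vertex uses all its edges equally often, including the one chosen by the initial `ρ`.
The visited vertices then form a closed set for `ρ`. -/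
theorem exists_routesTo {ρ : G.Config} (hρ : G.IsAcyclicConfig ρ) (x : W) :
    ∃ ρ', G.RoutesTo x ρ ρ' := by
  classical
  by_contra hx
  have hne : ∀ n, (G.step^[n] (ρ, some x)).2 ≠ none := fun n hn =>
    hx ⟨(G.step^[n] (ρ, some x)).1, n, Prod.ext rfl hn⟩
  obtain ⟨m, n, hmn, heq⟩ : ∃ m n, m < n ∧ G.step^[m] (ρ, some x) = G.step^[n] (ρ, some x) := by
    obtain ⟨m, n, hmn, heq⟩ := Finite.exists_ne_map_eq_of_infinite fun n =>
      G.step^[n] (ρ, some x)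
    rcases lt_or_gt_of_ne hmn with h | h
    · exact ⟨m, n, h, heq⟩
    · exact ⟨n, m, h, heq.symm⟩
  set s := G.step^[m] (ρ, some x) with hs
  have hloop : G.step^[n - m] (s.1, s.2) = s := by
    rw [Prod.mk.eta, hs, ← Function.iterate_add_apply, Nat.sub_add_cancel hmn.le, ← heq]
  obtain ⟨f, hf, h0, hpos⟩ := exists_isFlow_iterate_step (n - m) s.1 s.2
  rw [hloop] at hf
  obtain ⟨y, hy⟩ := Option.ne_none_iff_exists'.1 (hne m)
  obtain ⟨k, hk⟩ := hpos y hy (by omega)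
  refine hρ.not_closed (P := {y | ∃ k, 0 < f y k}) ⟨y, k, hk⟩ fun y ⟨k, hk⟩ => ?_
  refine exists_pos_of_netFlow_eq_zero (fun y => .inl (h0 y)) (left_eq_add.1 hf.balance) ?_
  rwa [(hf.rotation y).eq_of_refl (ρ y) k]

theorem isAcyclicConfig_of_routesTo {ρ ρ' : G.Config} {x : W} (hρ : G.IsAcyclicConfig ρ)
    (h : G.RoutesTo x ρ ρ') : G.IsAcyclicConfig ρ' := by
  obtain ⟨n, hn⟩ := h
  by_contra hρ'
  obtain ⟨P, hP, hclosed⟩ := exists_closed_of_not_isAcyclicConfig hρ'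
  refine not_closed_iterate_step n (ρ := ρ) (o := some x)
    (fun P hP hc => hρ.not_closed hP fun y hy => (hc y hy).2) P hP ?_
  rw [hn]
  exact fun y hy => ⟨Option.some_ne_none y, hclosed y hy⟩

/-! ### The particle addition operators and the action of their group. -/

theorem exists_isParticleAddition (G : RotorGraph W) (x : W) :
    ∃ f : Equiv.Perm G.Rec, G.IsParticleAddition x f := by
  choose e he using fun ρ : G.Rec => exists_routesTo ρ.2 x
  let e' : G.Rec → G.Rec := fun ρ => ⟨e ρ, isAcyclicConfig_of_routesTo ρ.2 (he ρ)⟩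
  have hinj : Function.Injective e' := by
    intro ρ₁ ρ₂ h
    have h1 := flowEquiv_of_routesTo (he ρ₁)
    have h2 := flowEquiv_of_routesTo (he ρ₂)
    rw [← show e ρ₁ = e ρ₂ from congrArg Subtype.val h] at h2
    exact Subtype.ext ((h1.trans h2.symm).eq ρ₁.2 ρ₂.2)
  exact ⟨Equiv.ofBijective e' (Finite.injective_iff_bijective.1 hinj), he⟩

/-- The vector `σ` does not depend on `ρ`, and by `FlowEquiv.eq` it determines `g`. Composition adds
these vectors, whence commutativity. -/
theorem exists_flowEquiv_of_mem_rotorRouterGroup {g : Equiv.Perm G.Rec}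
    (hg : g ∈ G.rotorRouterGroup) : ∃ σ : W → ℤ, ∀ ρ : G.Rec, FlowEquiv ρ.1 σ (g ρ).1 0 := by
  induction hg using Subgroup.closure_induction with
  | mem f hf =>
    obtain ⟨x, hx⟩ := hf
    exact ⟨_, fun ρ => flowEquiv_of_routesTo (hx ρ)⟩
  | one => exact ⟨0, fun ρ => ⟨0, .refl _ _⟩⟩
  | mul g k _ _ hg hk =>
    obtain ⟨σ, hσ⟩ := hg
    obtain ⟨τ, hτ⟩ := hk
    refine ⟨τ + σ, fun ρ => ((hτ ρ).add_right σ).trans ?_⟩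
    rw [zero_add]
    exact hσ (k ρ)
  | inv g _ hg =>
    obtain ⟨σ, hσ⟩ := hg
    refine ⟨-σ, fun ρ => ?_⟩
    have := ((hσ (g⁻¹ ρ)).add_right (-σ)).symm
    rwa [show g (g⁻¹ ρ) = ρ from g.apply_symm_apply ρ, add_neg_cancel, zero_add] at this

theorem exists_mem_rotorRouterGroup (σ : W → ℤ) :
    ∃ g ∈ G.rotorRouterGroup, ∀ ρ : G.Rec, FlowEquiv ρ.1 σ (g ρ).1 0 := by
  classical
  let A : AddSubgroup (W → ℤ) :=
    { carrier := {σ | ∃ g ∈ G.rotorRouterGroup, ∀ ρ : G.Rec, FlowEquiv ρ.1 σ (g ρ).1 0}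
      zero_mem' := ⟨1, one_mem _, fun ρ => ⟨0, .refl _ _⟩⟩
      add_mem' := by
        rintro σ τ ⟨g, hg, hσ⟩ ⟨k, hk, hτ⟩
        refine ⟨k * g, mul_mem hk hg, fun ρ => ((hσ ρ).add_right τ).trans ?_⟩
        rw [zero_add]
        exact hτ (g ρ)
      neg_mem' := by
        rintro σ ⟨g, hg, hσ⟩
        refine ⟨g⁻¹, inv_mem hg, fun ρ => ?_⟩
        have := ((hσ (g⁻¹ ρ)).add_right (-σ)).symm
        rwa [show g (g⁻¹ ρ) = ρ from g.apply_symm_apply ρ, add_neg_cancel, zero_add] at this }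
  have h1 : ∀ x, particle (some x) ∈ A := by
    intro x
    obtain ⟨f, hf⟩ := exists_isParticleAddition G x
    exact ⟨f, Subgroup.subset_closure ⟨x, hf⟩, fun ρ => flowEquiv_of_routesTo (hf ρ)⟩
  have h2 : σ = ∑ x, σ x • particle (some x) := by
    funext z
    simp [particle, Finset.sum_apply]
  show σ ∈ A
  rw [h2]
  exact sum_mem fun x _ => zsmul_mem (h1 x) _

theorem exists_apply_eq (ρ ρ' : G.Rec) : ∃ g ∈ G.rotorRouterGroup, g ρ = ρ' := by
  -- Turning the rotors from `ρ'` to `ρ` creates the particles `netFlow f`; adding these to `ρ` and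
  -- routing them to the sink gives back `ρ'`.
  choose f hf using fun y => IsRotation.exists_flow (ρ'.1 y) (ρ.1 y)
  obtain ⟨g, hg, h⟩ := exists_mem_rotorRouterGroup (G := G) (netFlow f)
  refine ⟨g, hg, Subtype.ext (FlowEquiv.eq (σ := 0) ?_ (g ρ).2 ρ'.2)⟩
  exact (FlowEquiv.trans ⟨f, hf, (zero_add _).symm⟩ (h ρ)).symm

theorem apply_apply_comm {g k : Equiv.Perm G.Rec} (hg : g ∈ G.rotorRouterGroup)
    (hk : k ∈ G.rotorRouterGroup) (ρ : G.Rec) : g (k ρ) = k (g ρ) := by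
  obtain ⟨σ, hσ⟩ := exists_flowEquiv_of_mem_rotorRouterGroup hg
  obtain ⟨τ, hτ⟩ := exists_flowEquiv_of_mem_rotorRouterGroup hk
  have h1 := (hτ ρ).add_right σ
  rw [zero_add] at h1
  have h2 := (hσ ρ).add_right τ
  rw [zero_add, add_comm] at h2
  exact Subtype.ext (((h1.trans (hσ (k ρ))).symm.trans (h2.trans (hτ (g ρ)))).eq
    (g (k ρ)).2 (k (g ρ)).2)

/-- The rotor-router group acts simply transitively on the recurrent configurations. -/
theorem card_rotorRouterGroup [Nonempty G.Rec] :
    Nat.card G.rotorRouterGroup = Nat.card G.Rec := by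
  obtain ⟨ρ₀⟩ := ‹Nonempty G.Rec›
  refine Nat.card_congr (Equiv.ofBijective (fun g : G.rotorRouterGroup => g.1 ρ₀) ⟨?_, ?_⟩)
  · rintro ⟨g, hg⟩ ⟨g', hg'⟩ (h : g ρ₀ = g' ρ₀)
    refine Subtype.ext (Equiv.ext fun ρ => ?_)
    obtain ⟨k, hk, rfl⟩ := exists_apply_eq ρ₀ ρ
    show g (k ρ₀) = g' (k ρ₀)
    -- A transitive action of an abelian group by permutations is free.
    rw [apply_apply_comm hg hk, apply_apply_comm hg' hk, h]
  · intro ρ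
    obtain ⟨k, hk, h⟩ := exists_apply_eq ρ₀ ρ
    exact ⟨⟨k, hk⟩, h⟩

end RotorGraph

/-! ### Rooted spanning forests and oriented spanning trees -/

theorem SimpleGraph.Reachable.exists_adj_dist_lt {U : Type*} {F : SimpleGraph U} {u t : U}
    (h : F.Reachable u t) (hne : u ≠ t) : ∃ v, F.Adj u v ∧ F.dist v t < F.dist u t := by
  obtain ⟨p, hp⟩ := h.exists_walk_length_eq_dist
  cases p with
  | nil => exact absurd rfl hne
  | cons hadj q =>
    refine ⟨_, hadj, ?_⟩
    have := F.dist_le q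
    rw [← hp, SimpleGraph.Walk.length_cons]
    omega

/-- The multigraph with sink `G` arises from the simple graph `H` when the set `S` is collapsed to
the sink: `ι` embeds the non-sink vertices, and `nb x k` is the endpoint in `H` of the `k`-th edge
at `x`. -/
structure IsCollapse {U W : Type*} (G : RotorGraph W) (H : SimpleGraph U) (S : Set U)
    (ι : W → U) (nb : (x : W) → Fin (G.deg x) → U) : Prop where
  nb_injective : ∀ x, Function.Injective (nb x)
  adj_iff : ∀ x v, H.Adj (ι x) v ↔ ∃ k, nb x k = v
  ι_injective : Function.Injective ι
  mem_iff : ∀ u, u ∈ S ↔ ∀ x, ι x ≠ u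
  nbr_iff : ∀ x k z, G.nbr x k = some z ↔ nb x k = ι z

/-- The graph whose edges are those chosen by the configuration `ρ`. -/
def chosenGraph {U W : Type*} {G : RotorGraph W} (ι : W → U) (nb : (x : W) → Fin (G.deg x) → U)
    (ρ : G.Config) : SimpleGraph U :=
  SimpleGraph.fromRel fun u v => ∃ x, u = ι x ∧ v = nb x (ρ x)

namespace IsCollapse

variable {U W : Type*} {G : RotorGraph W} {H : SimpleGraph U} {S : Set U} {ι : W → U}
  {nb : (x : W) → Fin (G.deg x) → U}

theorem adj_nb (hG : IsCollapse G H S ι nb) (x : W) (k : Fin (G.deg x)) :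
    H.Adj (ι x) (nb x k) := (hG.adj_iff x _).2 ⟨k, rfl⟩

theorem chosenGraph_adj (hG : IsCollapse G H S ι nb) {ρ : G.Config} {u v : U} :
    (chosenGraph ι nb ρ).Adj u v ↔
      ∃ x, u = ι x ∧ v = nb x (ρ x) ∨ v = ι x ∧ u = nb x (ρ x) := by
  rw [chosenGraph, SimpleGraph.fromRel_adj, exists_or]
  refine ⟨And.right, fun h => ⟨?_, h⟩⟩
  rcases h with ⟨x, rfl, rfl⟩ | ⟨x, rfl, rfl⟩
  · exact (hG.adj_nb x _).ne
  · exact (hG.adj_nb x _).ne'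

theorem chosenGraph_le (hG : IsCollapse G H S ι nb) (ρ : G.Config) : chosenGraph ι nb ρ ≤ H := by
  intro u v huv
  obtain ⟨x, ⟨rfl, rfl⟩ | ⟨rfl, rfl⟩⟩ := hG.chosenGraph_adj.1 huv
  · exact hG.adj_nb x _
  · exact (hG.adj_nb x _).symm

theorem chosenGraph_adj_of_mem (hG : IsCollapse G H S ι nb) {ρ : G.Config} {x : W} {s : U}
    (hs : s ∈ S) : (chosenGraph ι nb ρ).Adj (ι x) s ↔ nb x (ρ x) = s := by
  rw [hG.chosenGraph_adj]
  constructor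
  · rintro ⟨y, ⟨hxy, rfl⟩ | ⟨rfl, -⟩⟩
    · rw [hG.ι_injective hxy]
    · exact absurd rfl ((hG.mem_iff _).1 hs y)
  · rintro rfl
    exact ⟨x, .inl ⟨rfl, rfl⟩⟩

theorem mem_or (hG : IsCollapse G H S ι nb) (u : U) : u ∈ S ∨ ∃ x, u = ι x := by
  by_cases hu : u ∈ S
  · exact .inl hu
  · rw [hG.mem_iff] at hu
    push Not at hu
    obtain ⟨x, rfl⟩ := hu
    exact .inr ⟨x, rfl⟩

theorem exists_reachable [Finite W] (hG : IsCollapse G H S ι nb) {ρ : G.Config}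
    (hρ : G.IsAcyclicConfig ρ) (u : U) : ∃ s ∈ S, (chosenGraph ι nb ρ).Reachable u s := by
  rcases hG.mem_or u with hu | ⟨x, rfl⟩
  · exact ⟨u, hu, .refl u⟩
  · induction x using hρ.wellFounded.induction with
    | _ x ih =>
      have hx : (chosenGraph ι nb ρ).Adj (ι x) (nb x (ρ x)) :=
        hG.chosenGraph_adj.2 ⟨x, .inl ⟨rfl, rfl⟩⟩
      rcases hG.mem_or (nb x (ρ x)) with h | ⟨z, h⟩
      · exact ⟨_, h, hx.reachable⟩
      · obtain ⟨s, hs, hzs⟩ := ih z ((hG.nbr_iff _ _ _).2 h)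
        exact ⟨s, hs, hx.reachable.trans (h ▸ hzs)⟩

/-- Each vertex outside `S` has exactly one outgoing rotor and `t` has none, so the property that
the rotors lead to `t` is constant along edges in both directions. From `s`, which has no rotor,
they lead only to `s`. -/
theorem eq_of_reachable (hG : IsCollapse G H S ι nb) {ρ : G.Config} {s t : U} (hs : s ∈ S)
    (ht : t ∈ S) (h : (chosenGraph ι nb ρ).Reachable s t) : s = t := by
  let R : U → U → Prop := Relation.ReflTransGen fun u v => ∃ x, u = ι x ∧ v = nb x (ρ x)
  have hstep : ∀ x, R (nb x (ρ x)) t ↔ R (ι x) t := by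
    intro x
    constructor
    · exact fun h => .head ⟨x, rfl, rfl⟩ h
    · intro h
      rcases Relation.ReflTransGen.cases_head h with h | ⟨v, ⟨y, hxy, rfl⟩, hv⟩
      · exact absurd h ((hG.mem_iff _).1 ht x)
      · rwa [hG.ι_injective hxy]
  have hR : ∀ s, (chosenGraph ι nb ρ).Reachable s t → R s t := by
    intro s h
    rw [SimpleGraph.reachable_iff_reflTransGen] at h
    induction h using Relation.ReflTransGen.head_induction_on with
    | refl => exact .refl
    | head huv _ ih =>
      obtain ⟨x, ⟨rfl, rfl⟩ | ⟨rfl, rfl⟩⟩ := hG.chosenGraph_adj.1 huv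
      · exact (hstep x).1 ih
      · exact (hstep x).2 ih
  rcases Relation.ReflTransGen.cases_head (hR s h) with h | ⟨v, ⟨x, rfl, -⟩, -⟩
  · exact h
  · exact absurd rfl ((hG.mem_iff _).1 hs x)

theorem isRootedSpanningForest_chosenGraph [Finite W] (hG : IsCollapse G H S ι nb)
    (hH : H.IsAcyclic) {ρ : G.Config} (hρ : G.IsAcyclicConfig ρ) :
    IsRootedSpanningForest H S (chosenGraph ι nb ρ) := by
  refine ⟨hG.chosenGraph_le ρ, hH.anti (hG.chosenGraph_le ρ), fun C => ?_⟩
  induction C using SimpleGraph.ConnectedComponent.ind with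
  | _ u =>
    obtain ⟨s, hs, hus⟩ := hG.exists_reachable hρ u
    refine ⟨s, ⟨hs, SimpleGraph.ConnectedComponent.sound hus.symm⟩, fun t ⟨ht, htu⟩ => ?_⟩
    exact hG.eq_of_reachable ht hs ((SimpleGraph.ConnectedComponent.exact htu).trans hus)

/-- Where `ρ` and `ρ'` differ at `x`, the edge chosen by `ρ` must be chosen by `ρ'` from its other
end `y`. If they agreed at `y`, then `ρ` would have a two-cycle; so the set of disagreements is
closed under `ρ`. -/
theorem chosenGraph_injective [Finite W] (hG : IsCollapse G H S ι nb) {ρ ρ' : G.Config}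
    (hρ : G.IsAcyclicConfig ρ) (h : chosenGraph ι nb ρ = chosenGraph ι nb ρ') : ρ = ρ' := by
  by_contra hne
  obtain ⟨x, hx⟩ := Function.ne_iff.1 hne
  refine hρ.not_closed (P := {x | ρ x ≠ ρ' x}) ⟨x, hx⟩ fun x hx => ?_
  have hadj : (chosenGraph ι nb ρ').Adj (ι x) (nb x (ρ x)) :=
    h ▸ hG.chosenGraph_adj.2 ⟨x, .inl ⟨rfl, rfl⟩⟩
  obtain ⟨y, ⟨hxy, h1⟩ | ⟨h1, h2⟩⟩ := hG.chosenGraph_adj.1 hadj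
  · obtain rfl := hG.ι_injective hxy
    exact absurd (hG.nb_injective _ h1) hx
  · refine ⟨y, fun hy => ?_, (hG.nbr_iff _ _ _).2 h1⟩
    rw [← hy] at h2
    exact hρ x (.tail (.single ((hG.nbr_iff _ _ _).2 h1)) ((hG.nbr_iff _ _ _).2 h2.symm))

theorem exists_chosenGraph_eq [Finite W] (hG : IsCollapse G H S ι nb) {F : SimpleGraph U}
    (hF : IsRootedSpanningForest H S F) :
    ∃ ρ, G.IsAcyclicConfig ρ ∧ chosenGraph ι nb ρ = F := by
  obtain ⟨hFH, hFa, hFS⟩ := hF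
  choose s hs huniq using fun u => hFS (F.connectedComponentMk u)
  simp only at hs huniq
  have hreach : ∀ u, F.Reachable u (s u) := fun u =>
    (SimpleGraph.ConnectedComponent.exact (hs u).2).symm
  have heq : ∀ u v, F.Reachable u v → s u = s v := fun u v huv =>
    huniq v _ ⟨(hs u).1, SimpleGraph.ConnectedComponent.sound ((hreach u).symm.trans huv)⟩
  -- The rotor at `x` points along `F` towards the unique vertex of `S` in its component.
  have hnext : ∀ x, ∃ k, F.Adj (ι x) (nb x k) ∧
      F.dist (nb x k) (s (nb x k)) < F.dist (ι x) (s (ι x)) := by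
    intro x
    obtain ⟨v, hxv, hv⟩ := (hreach (ι x)).exists_adj_dist_lt ((hG.mem_iff _).1 (hs (ι x)).1 x)
    obtain ⟨k, rfl⟩ := (hG.adj_iff x v).1 (hFH hxv)
    exact ⟨k, hxv, by rwa [← heq _ _ hxv.reachable]⟩
  choose ρ hadj hdist using hnext
  have hle : chosenGraph ι nb ρ ≤ F := by
    intro u v huv
    obtain ⟨x, ⟨rfl, rfl⟩ | ⟨rfl, rfl⟩⟩ := hG.chosenGraph_adj.1 huv
    · exact hadj x
    · exact (hadj x).symm
  have hρ : G.IsAcyclicConfig ρ := by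
    by_contra hρ
    obtain ⟨P, hP, hclosed⟩ := RotorGraph.exists_closed_of_not_isAcyclicConfig hρ
    obtain ⟨x, hx, hmin⟩ := (measure fun x => F.dist (ι x) (s (ι x))).wf.has_min P hP
    obtain ⟨z, hz, hxz⟩ := hclosed x hx
    refine hmin z hz ?_
    have := hdist x
    rwa [(hG.nbr_iff _ _ _).1 hxz] at this
  refine ⟨ρ, hρ, le_antisymm hle fun u v huv => ?_⟩
  -- An edge of `F` missing from the chosen graph would not be a bridge of `F`: its ends are still
  -- joined through their common vertex of `S`.
  by_contra hnot
  obtain ⟨a, ha, hua⟩ := hG.exists_reachable hρ u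
  obtain ⟨b, hb, hvb⟩ := hG.exists_reachable hρ v
  have hab : a = b := by
    have h1 := huniq v a ⟨ha, SimpleGraph.ConnectedComponent.sound
      ((hua.mono hle).symm.trans huv.reachable)⟩
    have h2 := huniq v b ⟨hb, SimpleGraph.ConnectedComponent.sound (hvb.mono hle).symm⟩
    rw [h1, h2]
  refine SimpleGraph.isBridge_iff.1 (SimpleGraph.isAcyclic_iff_forall_adj_isBridge.1 hFa huv)
    ((hua.trans (hab ▸ hvb.symm)).mono fun c d hcd => ?_)
  rw [SimpleGraph.deleteEdges_adj]
  refine ⟨hle hcd, fun h => hnot ?_⟩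
  rw [Set.mem_singleton_iff, Sym2.eq_iff] at h
  rcases h with ⟨rfl, rfl⟩ | ⟨rfl, rfl⟩
  · exact hcd
  · exact hcd.symm

/-- Oriented spanning trees of the collapsed graph correspond to spanning forests rooted at `S`. -/
theorem ncard_forests [Finite W] (hG : IsCollapse G H S ι nb) (hH : H.IsAcyclic)
    (p : SimpleGraph U → Prop) :
    Set.ncard {F | IsRootedSpanningForest H S F ∧ p F} =
      Nat.card {ρ : G.Config // G.IsAcyclicConfig ρ ∧ p (chosenGraph ι nb ρ)} := by
  have himage : {F | IsRootedSpanningForest H S F ∧ p F} =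
      chosenGraph ι nb '' {ρ | G.IsAcyclicConfig ρ ∧ p (chosenGraph ι nb ρ)} := by
    ext F
    constructor
    · rintro ⟨hF, hp⟩
      obtain ⟨ρ, hρ, rfl⟩ := hG.exists_chosenGraph_eq hF
      exact ⟨ρ, ⟨hρ, hp⟩, rfl⟩
    · rintro ⟨ρ, ⟨hρ, hp⟩, rfl⟩
      exact ⟨hG.isRootedSpanningForest_chosenGraph hH hρ, hp⟩
  rw [himage, Set.InjOn.ncard_image fun ρ hρ ρ' _ h => hG.chosenGraph_injective hρ.1 h]
  rfl

end IsCollapse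

/-- A graph is acyclic if every edge joins a vertex with its parent, which has a smaller rank. -/
theorem SimpleGraph.isAcyclic_of_parent {U : Type*} {H : SimpleGraph U} (parent : U → U)
    (rank : U → ℕ) (hrank : ∀ u, rank (parent u) ≤ rank u) (h : ∀ u v, H.Adj u v →
      (parent u = v ∧ rank v < rank u) ∨ (parent v = u ∧ rank u < rank v)) : H.IsAcyclic := by
  have key : ∀ u v, H.Adj u v → parent u = v → rank v < rank u →
      ¬ (H.deleteEdges {s(u, v)}).Reachable u v := by
    intro u v huv hp hr hreach
    -- Without the edge to its parent, `u` reaches only its descendants, whose rank is at least that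
    -- of `u`; the parent `v` has smaller rank.
    have hdesc : ∀ w, (H.deleteEdges {s(u, v)}).Reachable u w → ∃ n, parent^[n] w = u := by
      intro w hw
      rw [SimpleGraph.reachable_iff_reflTransGen] at hw
      induction hw with
      | refl => exact ⟨0, rfl⟩
      | @tail a b _ hab ih =>
        obtain ⟨n, hn⟩ := ih
        rw [SimpleGraph.deleteEdges_adj] at hab
        rcases h a b hab.1 with ⟨hpa, -⟩ | ⟨hpb, -⟩
        · cases n with
          | zero =>
            obtain rfl : a = u := hn
            exact absurd (by rw [← hp, ← hpa]; rfl) hab.2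
          | succ n => exact ⟨n, by rw [← hpa]; exact hn⟩
        · exact ⟨n + 1, by rw [Function.iterate_succ_apply, hpb, hn]⟩
    obtain ⟨n, hn⟩ := hdesc v hreach
    have hle : ∀ n w, rank (parent^[n] w) ≤ rank w := by
      intro n
      induction n with
      | zero => exact fun w => le_rfl
      | succ n ih => exact fun w => (ih (parent w)).trans (hrank w)
    have := hle n v
    rw [hn] at this
    omega
  rw [SimpleGraph.isAcyclic_iff_forall_adj_isBridge]
  intro u v huv
  rw [SimpleGraph.isBridge_iff]
  rcases h u v huv with ⟨hp, hr⟩ | ⟨hp, hr⟩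
  · exact key u v huv hp hr
  · intro hreach
    refine key v u huv.symm hp hr ?_
    rw [Sym2.eq_swap]
    exact hreach.symm

section DirectedCover

universe u

variable {V : Type u} [Fintype V] {D : Matrix V V ℕ} {χ : (i : V) → Fin (outDeg D i) → V}

/-! ### The tree structure of the directed cover -/

namespace CoverVertex

theorem exists_child_eq : ∀ {i : V} (x y : CoverVertex χ i), x.ancestor = some y →
    ∃ k, y.child k = x
  | _, root, _, h => by simp [ancestor] at h
  | _, branch l x, y, h => by
    simp only [ancestor, Option.some.injEq] at h
    subst h
    cases hx : x.ancestor with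
    | none =>
      cases x with
      | root => exact ⟨l, rfl⟩
      | branch => simp [ancestor] at hx
    | some z =>
      obtain ⟨k, hk⟩ := exists_child_eq x z hx
      exact ⟨k, congrArg (branch l) hk⟩

theorem child_injective : ∀ {i : V} (x : CoverVertex χ i), Function.Injective x.child
  | _, root => fun k l h => by
    simp only [child] at h
    injection h
  | _, branch l x => fun k k' h => by
    simp only [child] at h
    injection h with _ _ h
    exact child_injective x h

theorem height_of_ancestor_eq {i : V} {x y : CoverVertex χ i} (h : x.ancestor = some y) :
    x.height = y.height + 1 := by
  obtain ⟨k, rfl⟩ := exists_child_eq x y h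
  exact height_child y k

theorem nbr_zero {i : V} (x : CoverVertex χ i) : x.nbr 0 = x.ancestor := rfl

theorem nbr_succ {i : V} (x : CoverVertex χ i) (k : Fin (outDeg D x.type)) :
    x.nbr k.succ = some (x.child k) := rfl

theorem nbr_injective {i : V} (x : CoverVertex χ i) : Function.Injective x.nbr := by
  have hne : ∀ k, x.ancestor ≠ some (x.child k) := fun k h => by
    have := height_of_ancestor_eq h
    rw [height_child] at this
    omega
  intro k l h
  cases k using Fin.cases with
  | zero =>
    cases l using Fin.cases with
    | zero => rfl
    | succ l => exact absurd h (hne l)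
  | succ k =>
    cases l using Fin.cases with
    | zero => exact absurd h.symm (hne k)
    | succ l => exact congrArg Fin.succ (x.child_injective (Option.some.inj h))

theorem exists_nbr_eq {i : V} {x y : CoverVertex χ i} {k} (h : x.nbr k = some y) :
    ∃ l, y.nbr l = some x := by
  cases k using Fin.cases with
  | zero =>
    obtain ⟨l, rfl⟩ := exists_child_eq x y h
    exact ⟨l.succ, rfl⟩
  | succ k =>
    obtain rfl : x.child k = y := Option.some.inj h
    exact ⟨0, ancestor_child x k⟩

theorem height_of_nbr_eq {i : V} {x y : CoverVertex χ i} {k} (h : x.nbr k = some y) :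
    x.height = y.height + 1 ∨ y.height = x.height + 1 := by
  cases k using Fin.cases with
  | zero => exact .inl (height_of_ancestor_eq h)
  | succ k =>
    obtain rfl : x.child k = y := Option.some.inj h
    exact .inr (height_child x k)

end CoverVertex

open CoverVertex

theorem plantedCover_adj_some {i : V} {x : CoverVertex χ i} {v : Option (CoverVertex χ i)} :
    (plantedCover χ i).Adj (some x) v ↔ ∃ k, x.nbr k = v := by
  rw [plantedCover, SimpleGraph.fromRel_adj]
  constructor
  · rintro ⟨-, ⟨y, k, hy, rfl⟩ | ⟨y, k, rfl, hx⟩⟩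
    · obtain rfl := Option.some.inj hy
      exact ⟨k, rfl⟩
    · exact exists_nbr_eq hx.symm
  · rintro ⟨k, rfl⟩
    refine ⟨fun h => ?_, .inl ⟨x, k, rfl, rfl⟩⟩
    rcases height_of_nbr_eq h.symm with h | h <;> omega

theorem plantedCover_isAcyclic (i : V) : (plantedCover χ i).IsAcyclic := by
  -- The added vertex `none` is its own parent and has rank `0`, so heights are shifted by one.
  refine SimpleGraph.isAcyclic_of_parent (fun v => v.bind ancestor)
    (fun v => v.elim 0 fun x => x.height + 1) ?_ ?_
  · rintro (_ | x)
    · simp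
    · cases h : x.ancestor with
      | none => simp [h]
      | some y => simp [h, height_of_ancestor_eq h]
  · have key : ∀ (x : CoverVertex χ i) (v : Option (CoverVertex χ i)),
        (plantedCover χ i).Adj (some x) v →
        (x.ancestor = v ∧ (v.elim 0 fun x => x.height + 1) < x.height + 1) ∨
        (v.bind ancestor = some x ∧ x.height + 1 < v.elim 0 fun x => x.height + 1) := by
      intro x v h
      obtain ⟨k, rfl⟩ := plantedCover_adj_some.1 h
      cases k using Fin.cases with
      | zero =>
        left
        refine ⟨rfl, ?_⟩
        rw [nbr_zero]
        cases h : x.ancestor with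
        | none => simp
        | some y => simp [height_of_ancestor_eq h]
      | succ k =>
        right
        rw [nbr_succ]
        simp [ancestor_child, height_child]
    rintro (_ | x) v h
    · cases v with
      | none => exact absurd rfl h.ne
      | some x => exact (key x none h.symm).symm
    · exact key x v h

theorem truncCover_isAcyclic (i : V) (h : ℕ) : (truncCover χ i h).IsAcyclic :=
  (plantedCover_isAcyclic i).induce _

instance finite_wiredVertex (i : V) (h : ℕ) : Finite (WiredVertex χ i h) := by
  induction h generalizing i with
  | zero =>
    have : IsEmpty (WiredVertex χ i 0) := ⟨fun x => Nat.not_lt_zero _ x.2⟩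
    infer_instance
  | succ h ih =>
    let f : Option (Σ k, WiredVertex χ (χ i k) h) → WiredVertex χ i (h + 1) := fun o =>
      o.elim ⟨root, Nat.succ_pos h⟩ fun y => ⟨branch y.1 y.2.1, Nat.succ_lt_succ y.2.2⟩
    refine Finite.of_surjective f ?_
    rintro ⟨_ | ⟨k, x⟩, hx⟩
    · exact ⟨none, rfl⟩
    · exact ⟨some ⟨k, x, Nat.lt_of_succ_lt_succ hx⟩, rfl⟩

theorem collapse_eq_some {i : V} {h : ℕ} {v : Option (CoverVertex χ i)} {z : WiredVertex χ i h} :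
    collapse χ i h v = some z ↔ v = some z.1 := by
  cases v with
  | none => simp [collapse]
  | some x =>
    simp only [collapse, Option.some.injEq]
    split_ifs with hx
    · rw [Option.some.injEq, Subtype.ext_iff]
    · simp only [false_iff]
      rintro rfl
      exact hx z.2

/-- The non-sink vertices as vertices of the truncated cover. -/
def WiredVertex.toTrunc {i : V} {h : ℕ} (x : WiredVertex χ i h) : truncVertices χ i h :=
  ⟨some x.1, fun _ hy => Option.some.inj hy ▸ x.2.le⟩

/-- The neighbours of a non-sink vertex as vertices of the truncated cover. -/
def WiredVertex.nbrTrunc {i : V} {h : ℕ} (x : WiredVertex χ i h)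
    (k : Fin (outDeg D x.1.type + 1)) : truncVertices χ i h :=
  ⟨x.1.nbr k, fun y hy => by
    have hx : x.1.height < h := x.2
    rcases height_of_nbr_eq hy with h | h <;> omega⟩

theorem isCollapse_wiredCover (i : V) (h : ℕ)
    (c : (x : WiredVertex χ i h) → Equiv.Perm (Fin (outDeg D x.1.type + 1))) :
    IsCollapse (wiredCover χ i h c) (truncCover χ i h) ({downSink χ i h} ∪ upSink χ i h)
      WiredVertex.toTrunc fun x k => x.nbrTrunc (c x k) where
  nb_injective x k l hkl := (c x).injective (x.1.nbr_injective (congrArg Subtype.val hkl))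
  adj_iff x v := by
    rw [truncCover, SimpleGraph.comap_adj]
    refine plantedCover_adj_some.trans ?_
    rw [← (c x).exists_congr_right]
    exact exists_congr fun k => (Subtype.ext_iff (a1 := x.nbrTrunc (c x k)) (a2 := v)).symm
  ι_injective x y hxy := Subtype.ext (Option.some.inj (congrArg Subtype.val hxy))
  mem_iff := by
    rintro ⟨_ | y, hy⟩
    · refine iff_of_true (.inl rfl) fun x hx => ?_
      exact Option.some_ne_none _ (congrArg Subtype.val hx)
    · constructor
      · rintro (h1 | ⟨z, h1, hz⟩) x hx
        · exact Option.some_ne_none _ (congrArg Subtype.val h1)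
        · have h2 : x.1 = y := Option.some.inj (congrArg Subtype.val hx)
          have h3 : y = z := Option.some.inj h1
          have h4 : x.1.height < h := x.2
          rw [h2, h3] at h4
          omega
      · intro hx
        refine .inr ⟨y, rfl, (hy y rfl).antisymm (not_lt.1 fun hlt => ?_)⟩
        exact hx ⟨y, hlt⟩ rfl
  nbr_iff x k z := collapse_eq_some.trans
    (Subtype.ext_iff (a1 := x.nbrTrunc (c x k)) (a2 := z.toTrunc)).symm

/-- The component of the root contains exactly one sink vertex, and a path to the down sink must use
the edge from the root, its only neighbour. -/
theorem exists_reachable_upSink_iff {i : V} {h : ℕ}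
    {F : SimpleGraph (truncVertices χ i h)}
    (hF : IsRootedSpanningForest (truncCover χ i h) ({downSink χ i h} ∪ upSink χ i h) F) :
    (∃ s ∈ upSink χ i h, F.Reachable (truncRoot χ i h) s) ↔
      ¬ F.Adj (truncRoot χ i h) (downSink χ i h) := by
  obtain ⟨s, ⟨hs, hrs⟩, huniq⟩ := hF.2.2 (F.connectedComponentMk (truncRoot χ i h))
  constructor
  · rintro ⟨t, ht, hrt⟩ hadj
    have h1 := huniq t ⟨.inr ht, SimpleGraph.ConnectedComponent.sound hrt.symm⟩
    have h2 := huniq _ ⟨.inl rfl, SimpleGraph.ConnectedComponent.sound hadj.symm.reachable⟩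
    obtain ⟨x, hx, -⟩ := ht
    rw [h1, ← h2] at hx
    exact Option.some_ne_none _ hx.symm
  · intro hnot
    rcases hs with hs | hs
    · exfalso
      obtain rfl : s = downSink χ i h := hs
      have hreach := SimpleGraph.ConnectedComponent.exact hrs
      obtain ⟨v, hv, -⟩ := hreach.exists_adj_dist_lt fun he =>
        Option.some_ne_none _ (congrArg Subtype.val he).symm
      have hv' : (plantedCover χ i).Adj none v.1 := hF.1 hv
      obtain ⟨_ | x, hx⟩ := v
      · exact hv'.ne rfl
      · obtain ⟨k, hk⟩ := plantedCover_adj_some.1 hv'.symm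
        cases k using Fin.cases with
        | zero =>
          cases x with
          | root => exact hnot hv.symm
          | branch => simp [nbr_zero, ancestor] at hk
        | succ k => simp [nbr_succ] at hk
    · exact ⟨s, hs, (SimpleGraph.ConnectedComponent.exact hrs).symm⟩

end DirectedCover

theorem Nat.card_subtype_split {α : Type*} [Finite α] (P Q : α → Prop) :
    Nat.card {a // P a} = Nat.card {a // P a ∧ Q a} + Nat.card {a // P a ∧ ¬ Q a} := by
  classical
  have := Fintype.ofFinite α
  simp only [Nat.card_eq_fintype_card, Fintype.card_subtype]
  rw [← Finset.filter_filter, ← Finset.filter_filter, Finset.card_filter_add_card_filter_not]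

section Counting

universe u

variable {V : Type u} [Fintype V] {D : Matrix V V ℕ} {χ : (i : V) → Fin (outDeg D i) → V}

open CoverVertex

/-! ### Counting configurations without backtracking -/

variable (χ) in
/-- A choice of a neighbour at every non-sink vertex of the wired cover. -/
abbrev NbrConfig (i : V) (h : ℕ) : Type u :=
  (x : WiredVertex χ i h) → Fin (outDeg D x.1.type + 1)

/-- No vertex chooses a child that chooses its ancestor. -/
def NoBacktrack {i : V} {h : ℕ} (ρ : NbrConfig χ i h) : Prop :=
  ∀ (x : WiredVertex χ i h) (k : Fin (outDeg D x.1.type)), ρ x = k.succ →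
    ∀ hk : (x.1.child k).height < h, ρ ⟨x.1.child k, hk⟩ ≠ 0

/-- The root does not choose its ancestor. This holds trivially if the root is part of the sink. -/
def LeadsUp {i : V} {h : ℕ} (ρ : NbrConfig χ i h) : Prop :=
  ∀ hr : (root : CoverVertex χ i).height < h, ρ ⟨root, hr⟩ ≠ 0

/-- In a closed set without backtracking, a vertex of greatest height pointing to a child would lead
to a higher one of the same kind. So all its vertices point to their ancestors, which is impossible
at least height. The trivial enumeration makes index `0` the ancestor. -/
theorem isAcyclicConfig_iff_noBacktrack {i : V} {h : ℕ} {ρ : NbrConfig χ i h} :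
    (wiredCover χ i h fun _ => 1).IsAcyclicConfig ρ ↔ NoBacktrack ρ := by
  have hnbr : ∀ x z, (wiredCover χ i h fun _ => 1).nbr x (ρ x) = some z ↔
      x.1.nbr (ρ x) = some z.1 := fun x z => collapse_eq_some
  constructor
  · intro hρ x k hx hk h0
    refine hρ x (.tail (.single ((hnbr x ⟨_, hk⟩).2 ?_)) ((hnbr _ x).2 ?_))
    · rw [hx]; rfl
    · rw [h0]; exact ancestor_child _ _
  · intro hρ
    by_contra hcyc
    obtain ⟨P, hP, hclosed⟩ := RotorGraph.exists_closed_of_not_isAcyclicConfig hcyc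
    have hdown : ∀ x ∈ P, ρ x = 0 := by
      by_contra! hne
      obtain ⟨x, ⟨hxP, hx⟩, hmax⟩ := (measure fun x : WiredVertex χ i h =>
        h - x.1.height).wf.has_min {x | x ∈ P ∧ ρ x ≠ 0} hne
      obtain ⟨k, hk⟩ := Fin.exists_succ_eq.2 hx
      obtain ⟨z, hzP, hz⟩ := hclosed x hxP
      rw [hnbr, ← hk, nbr_succ, Option.some.injEq] at hz
      have hlt : z.1.height < h := z.2
      obtain ⟨z, hzh⟩ := z
      simp only at hz hlt
      subst hz
      refine hmax ⟨x.1.child k, hzh⟩ ⟨hzP, hρ x k hk.symm hzh⟩ ?_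
      have := height_child x.1 k
      show h - (x.1.child k).height < h - x.1.height
      omega
    obtain ⟨x, hxP, hmin⟩ := (measure fun x : WiredVertex χ i h => x.1.height).wf.has_min P hP
    obtain ⟨z, hzP, hz⟩ := hclosed x hxP
    rw [hnbr, hdown x hxP, nbr_zero] at hz
    refine hmin z hzP ?_
    have := height_of_ancestor_eq hz
    show z.1.height < x.1.height
    omega

/-- The configuration on the `k`-th principal branch. -/
def branchConfig {i : V} {h : ℕ} (ρ : NbrConfig χ i (h + 1)) (k : Fin (outDeg D i)) :
    NbrConfig χ (χ i k) h :=
  fun x => ρ ⟨branch k x.1, Nat.succ_lt_succ x.2⟩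

/-- The choice at the root. -/
def rootChoice {i : V} {h : ℕ} (ρ : NbrConfig χ i (h + 1)) : Fin (outDeg D i + 1) :=
  ρ ⟨root, Nat.succ_pos h⟩

/-- A configuration consists of a choice at the root and configurations on the branches. -/
def nbrConfigEquiv (i : V) (h : ℕ) : NbrConfig χ i (h + 1) ≃
    Fin (outDeg D i + 1) × ((k : Fin (outDeg D i)) → NbrConfig χ (χ i k) h) where
  toFun ρ := (rootChoice ρ, branchConfig ρ)
  invFun p
    | ⟨root, _⟩ => p.1
    | ⟨branch k x, hx⟩ => p.2 k ⟨x, Nat.lt_of_succ_lt_succ hx⟩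
  left_inv ρ := by
    funext ⟨x, hx⟩
    cases x <;> rfl
  right_inv _ := rfl

theorem leadsUp_succ {i : V} {h : ℕ} {ρ : NbrConfig χ i (h + 1)} :
    LeadsUp ρ ↔ rootChoice ρ ≠ 0 :=
  ⟨fun hρ => hρ _, fun hρ _ => hρ⟩

theorem noBacktrack_succ {i : V} {h : ℕ} {ρ : NbrConfig χ i (h + 1)} :
    NoBacktrack ρ ↔ (∀ k, rootChoice ρ = k.succ → LeadsUp (branchConfig ρ k)) ∧
      ∀ k, NoBacktrack (branchConfig ρ k) := by
  constructor
  · intro hρ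
    exact ⟨fun k hk hr => hρ ⟨root, Nat.succ_pos h⟩ k hk (Nat.succ_lt_succ hr),
      fun k x l hx hl => hρ ⟨branch k x.1, Nat.succ_lt_succ x.2⟩ l hx (Nat.succ_lt_succ hl)⟩
  · rintro ⟨h1, h2⟩ ⟨_ | ⟨k, x⟩, hx⟩ l hl hc
    · exact h1 l hl (Nat.lt_of_succ_lt_succ hc)
    · exact h2 k ⟨x, Nat.lt_of_succ_lt_succ hx⟩ l hl (Nat.lt_of_succ_lt_succ hc)

variable (χ) in
/-- The number of configurations without backtracking. -/
noncomputable def cardNoBacktrack (i : V) (h : ℕ) : ℕ :=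
  Nat.card {ρ : NbrConfig χ i h // NoBacktrack ρ}

variable (χ) in
/-- The number of configurations without backtracking in which the root leads to the up sink. -/
noncomputable def cardUp (i : V) (h : ℕ) : ℕ :=
  Nat.card {ρ : NbrConfig χ i h // NoBacktrack ρ ∧ LeadsUp ρ}

variable (χ) in
/-- The number of configurations without backtracking in which the root chooses its ancestor. -/
noncomputable def cardDown (i : V) (h : ℕ) : ℕ :=
  Nat.card {ρ : NbrConfig χ i h // NoBacktrack ρ ∧ ¬ LeadsUp ρ}

theorem cardDown_add_cardUp (i : V) (h : ℕ) :
    cardDown χ i h + cardUp χ i h = cardNoBacktrack χ i h := by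
  rw [add_comm]
  exact (Nat.card_subtype_split _ _).symm

theorem cardNoBacktrack_pos (i : V) (h : ℕ) : 0 < cardNoBacktrack χ i h := by
  have : Nonempty {ρ : NbrConfig χ i h // NoBacktrack ρ} :=
    ⟨fun _ => 0, fun _ k hk => absurd hk.symm (Fin.succ_ne_zero k)⟩
  exact Nat.card_pos

theorem cardDown_succ (i : V) (h : ℕ) :
    cardDown χ i (h + 1) = ∏ k, cardNoBacktrack χ (χ i k) h := by
  simp only [cardNoBacktrack]
  rw [← Nat.card_pi]
  refine Nat.card_congr
    { toFun := fun ρ k => ⟨branchConfig ρ.1 k, (noBacktrack_succ.1 ρ.2.1).2 k⟩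
      invFun := fun b => ⟨(nbrConfigEquiv i h).symm (0, fun k => (b k).1), noBacktrack_succ.2
        ⟨fun k hk => absurd hk.symm (Fin.succ_ne_zero k), fun k => (b k).2⟩,
        fun hup => leadsUp_succ.1 hup rfl⟩
      left_inv := fun ρ => Subtype.ext ?_
      right_inv := fun b => rfl }
  have h0 : rootChoice ρ.1 = 0 := by
    have := ρ.2.2
    rwa [leadsUp_succ, not_not] at this
  rw [Equiv.symm_apply_eq]
  exact Prod.ext h0.symm rfl

/-- Counts the branches when the root chooses child `k`: only the branch `k` is constrained. The
quotient form keeps the full product as a common factor for `cardUp_succ`. -/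
theorem card_branchConfigs (i : V) (h : ℕ) (k : Fin (outDeg D i)) :
    (Nat.card {b : (l : Fin (outDeg D i)) → NbrConfig χ (χ i l) h //
      ∀ l, NoBacktrack (b l) ∧ (l = k → LeadsUp (b l))} : ℚ) =
      (∏ l, (cardNoBacktrack χ (χ i l) h : ℚ)) *
        ((cardUp χ (χ i k) h : ℚ) / cardNoBacktrack χ (χ i k) h) := by
  rw [Nat.card_congr (Equiv.subtypePiEquivPi
    (p := fun l (b : NbrConfig χ (χ i l) h) => NoBacktrack b ∧ (l = k → LeadsUp b))),
    Nat.card_pi, Nat.cast_prod, ← Finset.mul_prod_erase _ _ (Finset.mem_univ k),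
    ← Finset.mul_prod_erase _ (fun l => (cardNoBacktrack χ (χ i l) h : ℚ)) (Finset.mem_univ k)]
  have h1 : Nat.card {b : NbrConfig χ (χ i k) h // NoBacktrack b ∧ (k = k → LeadsUp b)} =
      cardUp χ (χ i k) h := by
    simp only [cardUp, true_imp_iff]
  have h2 : ∀ l ∈ Finset.univ.erase k,
      (Nat.card {b : NbrConfig χ (χ i l) h // NoBacktrack b ∧ (l = k → LeadsUp b)} : ℚ) =
        cardNoBacktrack χ (χ i l) h := by
    intro l hl
    simp only [cardNoBacktrack, Finset.ne_of_mem_erase hl, false_imp_iff, and_true]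
  rw [h1, Finset.prod_congr rfl h2]
  have h3 : (cardNoBacktrack χ (χ i k) h : ℚ) ≠ 0 :=
    Nat.cast_ne_zero.2 (cardNoBacktrack_pos _ _).ne'
  field_simp

theorem cardUp_succ (i : V) (h : ℕ) :
    (cardUp χ i (h + 1) : ℚ) = cardDown χ i (h + 1) *
      ∑ k, (cardUp χ (χ i k) h : ℚ) / cardNoBacktrack χ (χ i k) h := by
  rw [cardDown_succ, Nat.cast_prod, Finset.mul_sum]
  simp_rw [← card_branchConfigs]
  rw [← Nat.cast_sum, ← Nat.card_sigma]
  congr 1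
  let f : (Σ k, {b : (l : Fin (outDeg D i)) → NbrConfig χ (χ i l) h //
      ∀ l, NoBacktrack (b l) ∧ (l = k → LeadsUp (b l))}) →
      {ρ : NbrConfig χ i (h + 1) // NoBacktrack ρ ∧ LeadsUp ρ} := fun p =>
    ⟨(nbrConfigEquiv i h).symm (p.1.succ, p.2.1), noBacktrack_succ.2
      ⟨fun k hk => (p.2.2 k).2 (Fin.succ_injective _ hk).symm, fun k => (p.2.2 k).1⟩,
      leadsUp_succ.2 (Fin.succ_ne_zero p.1)⟩
  refine (Nat.card_congr (Equiv.ofBijective f ⟨?_, ?_⟩)).symm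
  · rintro ⟨k, b, hb⟩ ⟨k', b', hb'⟩ heq
    have h1 := (nbrConfigEquiv i h).symm.injective (congrArg Subtype.val heq)
    obtain ⟨h2, rfl⟩ := Prod.ext_iff.1 h1
    obtain rfl := Fin.succ_injective _ h2
    rfl
  · rintro ⟨ρ, hρ, hup⟩
    obtain ⟨k, hk⟩ := Fin.exists_succ_eq.2 (leadsUp_succ.1 hup)
    refine ⟨⟨k, branchConfig ρ, fun l => ⟨(noBacktrack_succ.1 hρ).2 l, ?_⟩⟩, Subtype.ext ?_⟩
    · rintro rfl
      exact (noBacktrack_succ.1 hρ).1 l hk.symm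
    · show (nbrConfigEquiv i h).symm (k.succ, branchConfig ρ) = ρ
      rw [Equiv.symm_apply_eq, hk]
      rfl

theorem noBacktrack_zero {i : V} (ρ : NbrConfig χ i 0) : NoBacktrack ρ :=
  fun x => absurd x.2 (Nat.not_lt_zero _)

theorem leadsUp_zero {i : V} (ρ : NbrConfig χ i 0) : LeadsUp ρ :=
  fun hr => absurd hr (Nat.not_lt_zero _)

theorem cardNoBacktrack_zero (i : V) : cardNoBacktrack χ i 0 = 1 := by
  have : IsEmpty (WiredVertex χ i 0) := ⟨fun x => Nat.not_lt_zero _ x.2⟩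
  rw [cardNoBacktrack, Nat.card_congr (Equiv.subtypeUnivEquiv noBacktrack_zero)]
  exact Nat.card_unique

theorem cardUp_zero (i : V) : cardUp χ i 0 = 1 := by
  rw [← cardNoBacktrack_zero (χ := χ) i]
  simp only [cardUp, cardNoBacktrack, leadsUp_zero, and_true]

/-! ### Counting forests -/

theorem chosenGraph_adj_downSink {i : V} {h : ℕ} (ρ : NbrConfig χ i (h + 1)) :
    (chosenGraph (G := wiredCover χ i (h + 1) fun _ => 1) WiredVertex.toTrunc
      (fun x k => x.nbrTrunc k) ρ).Adj (truncRoot χ i (h + 1)) (downSink χ i (h + 1)) ↔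
      ¬ LeadsUp ρ := by
  rw [leadsUp_succ, not_not]
  refine ((isCollapse_wiredCover i (h + 1) fun _ => 1).chosenGraph_adj_of_mem
    (x := (⟨root, Nat.succ_pos h⟩ : WiredVertex χ i (h + 1))) (s := downSink χ i (h + 1)) (.inl rfl)).trans ?_
  have h1 : (root : CoverVertex χ i).nbr (rootChoice ρ) = none ↔ rootChoice ρ = 0 :=
    (nbr_injective (root : CoverVertex χ i)).eq_iff (b := 0)
  exact Subtype.ext_iff.trans h1

theorem forestsDown_succ (i : V) (h : ℕ) : forestsDown χ i (h + 1) = cardDown χ i (h + 1) := by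
  rw [forestsDown, (isCollapse_wiredCover i (h + 1) fun _ => 1).ncard_forests
    (truncCover_isAcyclic i (h + 1))]
  refine Nat.card_congr (Equiv.subtypeEquivRight fun ρ => ?_)
  exact and_congr isAcyclicConfig_iff_noBacktrack (chosenGraph_adj_downSink ρ)

theorem forestsUp_eq_ncard (i : V) (h : ℕ) : forestsUp χ i h =
    Set.ncard {F | IsRootedSpanningForest (truncCover χ i h) ({downSink χ i h} ∪ upSink χ i h) F ∧
      ¬ F.Adj (truncRoot χ i h) (downSink χ i h)} := by
  rw [forestsUp]
  congr 1
  ext F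
  exact and_congr_right exists_reachable_upSink_iff

theorem forestsUp_succ (i : V) (h : ℕ) : forestsUp χ i (h + 1) = cardUp χ i (h + 1) := by
  rw [forestsUp_eq_ncard, (isCollapse_wiredCover i (h + 1) fun _ => 1).ncard_forests
    (truncCover_isAcyclic i (h + 1)) fun F => ¬ F.Adj _ _]
  refine Nat.card_congr (Equiv.subtypeEquivRight fun ρ => ?_)
  exact and_congr isAcyclicConfig_iff_noBacktrack
    ((not_congr (chosenGraph_adj_downSink ρ)).trans not_not)

theorem card_rec_wiredCover (i : V) (h : ℕ)
    (c : (x : WiredVertex χ i h) → Equiv.Perm (Fin (outDeg D x.1.type + 1))) :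
    Nat.card (wiredCover χ i h c).Rec = forestsDown χ i h + forestsUp χ i h := by
  rw [forestsUp_eq_ncard, forestsDown, (isCollapse_wiredCover i h c).ncard_forests
    (truncCover_isAcyclic i h), (isCollapse_wiredCover i h c).ncard_forests
    (truncCover_isAcyclic i h) fun F => ¬ F.Adj _ _]
  exact Nat.card_subtype_split _ _

end Counting

/-- Turns sums over children into sums over labels, with the multiplicities `D i j` of `χ i`. -/
theorem Finset.sum_fiber_card {V ι M : Type*} [Fintype V] [Fintype ι] [CommSemiring M] (g : ι → V)
    (n : V → ℕ) (hn : ∀ j, Nat.card {k // g k = j} = n j) (f : V → M) :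
    ∑ k, f (g k) = ∑ j, n j * f j := by
  classical
  rw [← Finset.sum_fiberwise Finset.univ g]
  refine Finset.sum_congr rfl fun j _ => ?_
  rw [Finset.sum_congr rfl fun k hk => by rw [(Finset.mem_filter.1 hk).2], Finset.sum_const,
    nsmul_eq_mul, ← hn j, Nat.card_eq_fintype_card, Fintype.card_subtype]

theorem Finset.prod_fiber_card {V ι M : Type*} [Fintype V] [Fintype ι] [CommMonoid M] (g : ι → V)
    (n : V → ℕ) (hn : ∀ j, Nat.card {k // g k = j} = n j) (f : V → M) :
    ∏ k, f (g k) = ∏ j, f j ^ n j := by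
  classical
  rw [← Finset.prod_fiberwise Finset.univ g]
  refine Finset.prod_congr rfl fun j _ => ?_
  rw [Finset.prod_congr rfl fun k hk => by rw [(Finset.mem_filter.1 hk).2], Finset.prod_const,
    ← hn j, Nat.card_eq_fintype_card, Fintype.card_subtype]

theorem mainTheorem1 {V : Type*} [Fintype V] (D : Matrix V V ℕ)
    (χ : (i : V) → Fin (outDeg D i) → V)
    (hχ : ∀ i j : V, Nat.card {k : Fin (outDeg D i) // χ i k = j} = D i j) :
    (∀ (i : V) (h : ℕ), 1 ≤ h →
      ∀ c : (x : WiredVertex χ i h) → Equiv.Perm (Fin (outDeg D x.1.type + 1)),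
        (∀ x : WiredVertex χ i h, ∃ f : Equiv.Perm (wiredCover χ i h c).Rec,
          (wiredCover χ i h c).IsParticleAddition x f) ∧
        Nat.card (wiredCover χ i h c).rotorRouterGroup =
          forestsDown χ i h + forestsUp χ i h) ∧
    (∀ (i : V) (h : ℕ), 2 ≤ h →
      forestsDown χ i h =
        ∏ j : V, (forestsDown χ j (h - 1) + forestsUp χ j (h - 1)) ^ D i j ∧
      (forestsUp χ i h : ℚ) =
        (forestsDown χ i h : ℚ) * ∑ j : V, ((D i j : ℚ) * (forestsUp χ j (h - 1) : ℚ)) /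
          ((forestsDown χ j (h - 1) : ℚ) + (forestsUp χ j (h - 1) : ℚ))) ∧
    (∀ i : V, forestsDown χ i 1 = 1 ∧ forestsUp χ i 1 = outDeg D i) := by
  have htotal : ∀ (j : V) (h : ℕ),
      forestsDown χ j (h + 1) + forestsUp χ j (h + 1) = cardNoBacktrack χ j (h + 1) :=
    fun j h => by rw [forestsDown_succ, forestsUp_succ, cardDown_add_cardUp]
  refine ⟨fun i h hh c => ?_, fun i h hh => ?_, fun i => ?_⟩
  · have := Fintype.ofFinite (WiredVertex χ i h)
    refine ⟨RotorGraph.exists_isParticleAddition _, ?_⟩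
    obtain ⟨h, rfl⟩ := Nat.exists_eq_add_of_le' hh
    have hcard := card_rec_wiredCover i (h + 1) c
    have hpos : 0 < Nat.card (wiredCover χ i (h + 1) c).Rec := by
      rw [hcard, htotal]
      exact cardNoBacktrack_pos _ _
    have := (Nat.card_pos_iff.1 hpos).1
    rw [RotorGraph.card_rotorRouterGroup, hcard]
  · obtain ⟨h, rfl⟩ := Nat.exists_eq_add_of_le' hh
    rw [show h + 2 - 1 = h + 1 from rfl]
    simp_rw [← Nat.cast_add, htotal]
    refine ⟨?_, ?_⟩
    · rw [forestsDown_succ, cardDown_succ,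
        Finset.prod_fiber_card _ _ (hχ i) fun j => cardNoBacktrack χ j (h + 1)]
    · rw [forestsDown_succ, forestsUp_succ, cardUp_succ, Finset.sum_fiber_card _ _ (hχ i)
        fun j => (cardUp χ j (h + 1) : ℚ) / cardNoBacktrack χ j (h + 1)]
      simp_rw [mul_div_assoc, forestsUp_succ]
  · rw [forestsDown_succ, forestsUp_succ]
    have hdown : cardDown χ i 1 = 1 := by
      simp [cardDown_succ, cardNoBacktrack_zero]
    refine ⟨hdown, ?_⟩
    -- At height `0` every branch root is in the up sink and `LeadsUp` holds vacuously, so each of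
    -- the `outDeg D i` summands is `1`.
    have hup := cardUp_succ (χ := χ) i 0
    rw [zero_add, hdown] at hup
    simp only [cardUp_zero, cardNoBacktrack_zero, Nat.cast_one, div_one, Finset.sum_const,
      Finset.card_univ, Fintype.card_fin, nsmul_eq_mul, mul_one, one_mul] at hup
    exact_mod_cast hup
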